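/- All probability spaces are standard. For a countable group $\Gamma$ and a standard probability space $(Y,\nu)$, the Bernoulli action $\Gamma \curvearrowright Y^\Gamma$ with base $(Y,\nu)$ is the action $(g\cdot x)_h = x_{hg}$ on $Y^\Gamma$ with the product measure. For a second countable compact (Hausdorff) group $K$ with normalized Haar measure, $\Gamma \curvearrowright K^\Gamma/K$ is the factor of the Bernoulli action $\Gamma\curvearrowright K^\Gamma$ on the space of orbits of the diagonal left translation action $(k\cdot x)_h = k x_h$ of $K$, equipped with the image of the product measure. Two probability measure preserving actions $\Gamma \curvearrowright (X_0,\mu_0)$ and $\Gamma \curvearrowright (X_1,\mu_1)$ are isomorphic if there is a measure preserving Borel bijection $\Delta$ between conegligible Borel subsets of $X_0$ and $X_1$ such that, for every $g \in \Gamma$, $\Delta(g\cdot x) = g\cdot\Delta(x)$ for a.e. $x \in X_0$. **Theorem.** Let $\Gamma_0,\Gamma_1$ be countable groups and let $G = \Gamma_0 * \Gamma_1$ be their free product. 1. Let $K$ be a nontrivial second countable compact group and let $(Y_0,\nu_0)$, $(Y_1,\nu_1)$ be standard probability spaces. If, for $i = 0,1$, the action $\Gamma_i \curvearrowright K^{\Gamma_i}/K$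 is isomorphic to the Bernoulli action $\Gamma_i \curvearrowright Y_i^{\Gamma_i}$ with base $(Y_i,\nu_i)$, then $G \curvearrowright K^G/K$ is isomorphic to the Bernoulli action $G \curvearrowright (Y_0\times Y_1)^G$ with base $(Y_0 \times Y_1, \nu_0\times\nu_1)$. 2. Hence, for every nontrivial second countable compact group $K$, the class of countably infinite groups $\Gamma$ for which $\Gamma \curvearrowright K^\Gamma/K$ is isomorphic to some Bernoulli action of $\Gamma$ is closed under free products of two groups. The same holds for the class of countably infinite groups that have this property for every nontrivial second countable compact group $K$. -/

import Mathlib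

open MeasureTheory

universe u v w u₀ u₁

/-- A probability measure preserving (p.m.p.) action of the group `Γ` on a standard probability
space `(X, μ)`. -/
structure PMPAction (Γ : Type u) [Group Γ] where
  /-- the underlying space -/
  X : Type v
  [measurableSpace : MeasurableSpace X]
  [standardBorel : StandardBorelSpace X]
  /-- the invariant probability measure -/
  μ : Measure X
  [isProb : IsProbabilityMeasure μ]
  [mulAction : MulAction Γ X]
  measurePreserving : ∀ g : Γ, MeasurePreserving (fun x : X => g • x) μ μ

attribute [instance] PMPAction.measurableSpace PMPAction.standardBorel PMPAction.isProb
  PMPAction.mulAction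

/-- `Δ` is an isomorphism of the probability spaces `(X, μ)` and `(Y, ν)`: a measure preserving
Borel map which restricts to a bijection between conegligible Borel sets. (For standard Borel
spaces the inverse of such a restriction is automatically Borel.) -/
def IsProbSpaceIso {X : Type v} {Y : Type w} [MeasurableSpace X] [MeasurableSpace Y]
    (μ : Measure X) (ν : Measure Y) (Δ : X → Y) : Prop :=
  MeasurePreserving Δ μ ν ∧
    ∃ (A : Set X) (B : Set Y), MeasurableSet A ∧ MeasurableSet B ∧ μ Aᶜ = 0 ∧ ν Bᶜ = 0 ∧
      Set.BijOn Δ A B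

/-- Two p.m.p. actions of the same group are isomorphic if there is an isomorphism `Δ` of
probability spaces with `Δ (g • x) = g • Δ x` for all `g` and almost every `x`. -/
def PMPAction.Isomorphic {Γ : Type u} [Group Γ] (a : PMPAction.{u, v} Γ)
    (b : PMPAction.{u, w} Γ) : Prop :=
  ∃ Δ : a.X → b.X, IsProbSpaceIso a.μ b.μ Δ ∧ ∀ g : Γ, ∀ᵐ x ∂a.μ, Δ (g • x) = g • Δ x

/-- The shift `(g • x)_h = x_{hg}` of `Γ` on `Y ^ Γ`. -/
@[reducible] def shiftAction (Γ : Type u) [Group Γ] (Y : Type v) : MulAction Γ (Γ → Y) where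
  smul g x := fun h => x (h * g)
  one_smul x := funext fun h => congrArg x (mul_one h)
  mul_smul g k x := funext fun h => congrArg x (mul_assoc h g k).symm

theorem measurePreserving_shift (Γ : Type u) [Group Γ] {Y : Type v} [MeasurableSpace Y]
    (ν : Measure Y) [IsProbabilityMeasure ν] (g : Γ) :
    MeasurePreserving (fun (x : Γ → Y) (h : Γ) => x (h * g))
      (Measure.infinitePi fun _ : Γ => ν) (Measure.infinitePi fun _ : Γ => ν) :=
  ⟨by fun_prop, Measure.map_infinitePi_infinitePi_of_inj (mul_left_injective g)⟩

/-- The Bernoulli action `Γ ↷ Y ^ Γ` with base space `(Y, ν)`: the shift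
`(g • x)_h = x_{hg}` on `Y ^ Γ` with the product measure. -/
noncomputable def bernoulliAction (Γ : Type u) [Group Γ] [Countable Γ] (Y : Type v)
    [MeasurableSpace Y] [StandardBorelSpace Y] (ν : Measure Y) [IsProbabilityMeasure ν] :
    PMPAction.{u, max u v} Γ :=
  { X := Γ → Y
    mulAction := shiftAction Γ Y
    μ := Measure.infinitePi fun _ : Γ => ν
    measurePreserving := measurePreserving_shift Γ ν }

/-- The normalized Haar measure of a compact group. -/
noncomputable def normalizedHaar (K : Type v) [Group K] [TopologicalSpace K]
    [IsTopologicalGroup K] [CompactSpace K] [MeasurableSpace K] [BorelSpace K] : Measure K :=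
  Measure.haarMeasure (⊤ : TopologicalSpace.PositiveCompacts K)

instance instIsProbabilityMeasureNormalizedHaar (K : Type v) [Group K] [TopologicalSpace K]
    [IsTopologicalGroup K] [CompactSpace K] [MeasurableSpace K] [BorelSpace K] :
    IsProbabilityMeasure (normalizedHaar K) :=
  ⟨by simpa [normalizedHaar] using
    Measure.haarMeasure_self (K₀ := (⊤ : TopologicalSpace.PositiveCompacts K))⟩

/-- The orbit space `K ^ Γ / K` of the diagonal left translation action
`(k • x)_h = k * x_h` of `K` on `K ^ Γ`. It carries the quotient σ-algebra. -/
abbrev DiagQuotient (K : Type v) [Group K] (Γ : Type u) : Type (max u v) :=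
  MulAction.orbitRel.Quotient K (Γ → K)

/-- The quotient map `K ^ Γ → K ^ Γ / K`. -/
def DiagQuotient.mk (K : Type v) [Group K] (Γ : Type u) (x : Γ → K) : DiagQuotient K Γ :=
  Quotient.mk (MulAction.orbitRel K (Γ → K)) x

theorem DiagQuotient.measurable_mk (K : Type v) [Group K] [MeasurableSpace K] (Γ : Type u) :
    Measurable (DiagQuotient.mk K Γ) :=
  fun _ hs => hs

theorem polishSpace_of_compact_t2_secondCountable (X : Type v) [TopologicalSpace X]
    [CompactSpace X] [T2Space X] [SecondCountableTopology X] : PolishSpace X := by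
  let _ := TopologicalSpace.metrizableSpaceMetric X
  infer_instance

/-- The quotient σ-algebra is standard: it is the Borel σ-algebra of the (compact, metrizable)
quotient topology. -/
instance instStandardBorelSpaceDiagQuotient (K : Type v) [Group K] [TopologicalSpace K]
    [IsTopologicalGroup K] [CompactSpace K] [T2Space K] [SecondCountableTopology K] [MeasurableSpace K] [BorelSpace K]
    (Γ : Type u) [Countable Γ] :
    StandardBorelSpace (DiagQuotient K Γ) := by
  have : ProperSMul K (Γ → K) :=
    ⟨Continuous.isProperMap (by fun_prop)⟩
  have : SecondCountableTopology (DiagQuotient K Γ) :=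
    ContinuousConstSMul.secondCountableTopology
  have : PolishSpace (Γ → K) := polishSpace_of_compact_t2_secondCountable _
  have : BorelSpace (DiagQuotient K Γ) :=
    ⟨(continuous_quotient_mk'.map_eq_borel
      (X := Γ → K) (Y := DiagQuotient K Γ) Quotient.mk_surjective)⟩
  have : CompactSpace (DiagQuotient K Γ) := Quotient.compactSpace
  have : PolishSpace (DiagQuotient K Γ) := polishSpace_of_compact_t2_secondCountable _
  infer_instance

/-- The shift of one group element on `K ^ Γ / K`: the class of `x` goes to the class of
`h ↦ x_{hg}`. -/
def DiagQuotient.shift (K : Type v) [Group K] (Γ : Type u) [Group Γ] (g : Γ) :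
    DiagQuotient K Γ → DiagQuotient K Γ :=
  Quotient.map (fun (x : Γ → K) (h : Γ) => x (h * g)) (by
    rintro _ y ⟨k, rfl⟩
    exact ⟨k, rfl⟩)

/-- The action of `Γ` on `K ^ Γ / K` induced by the shift. -/
@[reducible] def DiagQuotient.shiftAction (K : Type v) [Group K] (Γ : Type u) [Group Γ] :
    MulAction Γ (DiagQuotient K Γ) where
  smul g x := DiagQuotient.shift K Γ g x
  one_smul := by
    rintro ⟨x⟩
    exact congrArg (DiagQuotient.mk K Γ) (funext fun h => congrArg x (mul_one h))
  mul_smul g k := by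
    rintro ⟨x⟩
    exact congrArg (DiagQuotient.mk K Γ) (funext fun h => congrArg x (mul_assoc h g k).symm)

/-- The image on `K ^ Γ / K` of the product of the normalized Haar measures. -/
noncomputable def DiagQuotient.measure (K : Type v) [Group K] [TopologicalSpace K]
    [IsTopologicalGroup K] [CompactSpace K] [MeasurableSpace K] [BorelSpace K] (Γ : Type u) :
    Measure (DiagQuotient K Γ) :=
  (Measure.infinitePi fun _ : Γ => normalizedHaar K).map (DiagQuotient.mk K Γ)

instance instIsProbabilityMeasureDiagQuotient (K : Type v) [Group K] [TopologicalSpace K]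
    [IsTopologicalGroup K] [CompactSpace K] [MeasurableSpace K] [BorelSpace K] (Γ : Type u) :
    IsProbabilityMeasure (DiagQuotient.measure K Γ) :=
  Measure.isProbabilityMeasure_map (DiagQuotient.measurable_mk K Γ).aemeasurable

theorem DiagQuotient.measurePreserving_shift (K : Type v) [Group K] [TopologicalSpace K]
    [IsTopologicalGroup K] [CompactSpace K] [MeasurableSpace K] [BorelSpace K] (Γ : Type u) [Group Γ] (g : Γ) :
    MeasurePreserving (DiagQuotient.shift K Γ g) (DiagQuotient.measure K Γ)
      (DiagQuotient.measure K Γ) := by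
  have h1 := _root_.measurePreserving_shift Γ (normalizedHaar K) g
  have hmk := DiagQuotient.measurable_mk K Γ
  have hm : Measurable (DiagQuotient.shift K Γ g) := fun s hs => h1.measurable (hmk hs)
  refine ⟨hm, ?_⟩
  have hc : DiagQuotient.shift K Γ g ∘ DiagQuotient.mk K Γ =
      DiagQuotient.mk K Γ ∘ fun (x : Γ → K) (h : Γ) => x (h * g) := rfl
  rw [DiagQuotient.measure, Measure.map_map hm hmk, hc, ← Measure.map_map hmk h1.measurable,
    h1.map_eq]

/-- The factor action `Γ ↷ K ^ Γ / K` of the Bernoulli action `Γ ↷ K ^ Γ` by the diagonal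
translation action of `K`. -/
noncomputable def factorAction (K : Type v) [Group K] [TopologicalSpace K]
    [IsTopologicalGroup K] [CompactSpace K] [T2Space K] [SecondCountableTopology K] [MeasurableSpace K] [BorelSpace K]
    (Γ : Type u) [Group Γ] [Countable Γ] :
    PMPAction.{u, max u v} Γ :=
  { X := DiagQuotient K Γ
    mulAction := DiagQuotient.shiftAction K Γ
    μ := DiagQuotient.measure K Γ
    measurePreserving := DiagQuotient.measurePreserving_shift K Γ }

/-- `Γ` is infinite (and countable) and `Γ ↷ K ^ Γ / K` is isomorphic with a Bernoulli action of
`Γ`. Every standard Borel space has a copy in `Type`, so this is no restriction on the base. -/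
def HasBernoulliFactor (K : Type v) [Group K] [TopologicalSpace K]
    [IsTopologicalGroup K] [CompactSpace K] [T2Space K] [SecondCountableTopology K] [MeasurableSpace K] [BorelSpace K]
    (Γ : Type u) [Group Γ] [Countable Γ] : Prop :=
  Infinite Γ ∧
    ∃ (Y : Type) (_ : MeasurableSpace Y) (_ : StandardBorelSpace Y) (ν : Measure Y)
      (_ : IsProbabilityMeasure ν), (factorAction K Γ).Isomorphic (bernoulliAction Γ Y ν)

/-- `Γ` is countably infinite and, for every nontrivial second countable compact group `K`, the
action `Γ ↷ K ^ Γ / K` is isomorphic with a Bernoulli action of `Γ`. -/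
def HasAllBernoulliFactors (Γ : Type u) [Group Γ] [Countable Γ] : Prop :=
  ∀ (K : Type v) [Group K] [TopologicalSpace K] [IsTopologicalGroup K] [CompactSpace K]
    [T2Space K] [SecondCountableTopology K] [Nontrivial K] [MeasurableSpace K] [BorelSpace K],
    HasBernoulliFactor K Γ

/-- The free product of two countable groups is countable. -/
instance instCountableCoprod (Γ₀ : Type u) (Γ₁ : Type v) [Group Γ₀] [Group Γ₁] [Countable Γ₀]
    [Countable Γ₁] : Countable (Monoid.Coprod Γ₀ Γ₁) :=
  have : Countable (FreeMonoid (Γ₀ ⊕ Γ₁)) := inferInstanceAs (Countable (List (Γ₀ ⊕ Γ₁)))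
  Monoid.Coprod.mk_surjective.countable

/-!
Let `G` be the free product of `Γ₀` and `Γ₁`. The right cosets of the two factors in `G`, with an
element `g` of `G` as an edge joining `Γ₀ g` and `Γ₁ g`, form the Bass--Serre tree of the free
product. A point of `K ^ G` modulo `K` amounts to its increments `x_g⁻¹ x_h`, and because of the
tree structure, increments inside distinct cosets can be prescribed independently. So `K ^ G / K`
is the product of the spaces `K ^ C / K` over all cosets `C`. In other words, `G ↷ K ^ G / K` is
the product of the actions coinduced from `Γᵢ ↷ K ^ Γᵢ / K`. Coinduction turns the Bernoulli
action of `Γᵢ` with base `Yᵢ` into that of `G`, and a product of Bernoulli actions is a Bernoulli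
action with the product base.

Explicitly, isomorphisms `Δᵢ : K ^ Γᵢ / K → Yᵢ ^ Γᵢ` give the map `Δ : K ^ G / K → (Y₀ × Y₁) ^ G`
for which the components of `Δ(ω)_g` are the coordinates at `1` of `Δᵢ` applied to the restriction
of `ω` to `Γᵢ g` (`DiagQuotient.coind`). It is equivariant everywhere.

* Each component of `Δ` is measure preserving, as distinct cosets of one factor are disjoint
  (`DiagQuotient.measurePreserving_coind`).
* The two components are independent. Let the parent of an element of `G` be obtained by deleting
  the first letter of its reduced word (`exists_isParentSystem_coprod`). By left invariance and
  induction on the word length, the increments of `x` from parents to children are again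
  independent and Haar distributed (`measurePreserving_increments`). The component of `Δ` for `Γᵢ`
  only depends on the increments at words which begin with a letter of `Γᵢ`
  (`DiagQuotient.coind_mk_mask_increments`).
* `Δ` is injective on a conegligible set, as `Δᵢ` is and the two factors generate `G`
  (`DiagQuotient.eq_of_restrictCoset_eq`). By the Lusin--Souslin theorem this makes it an
  isomorphism.
-/

/-! ### First letters in a free product -/

/-- Let `Γ` act on `G` by left translation along `φ : Γ →* G`. The complement of `A` is a set of
representatives of the orbits, `Γ` acts freely, and `p` sends each element of `A` to the
representative of its orbit. In a free product, `A` is the set of elements whose reduced word starts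
with a letter of the factor `Γ`, and `p` deletes this letter. -/
structure IsParentSystem {Γ : Type u} {G : Type v} [Group Γ] [Group G] (φ : Γ →* G) (A : Set G)
    (p : G → G) : Prop where
  parent_notMem : ∀ g ∈ A, p g ∉ A
  exists_eq_mul_parent : ∀ g ∈ A, ∃ γ : Γ, g = φ γ * p g
  mul_mem : ∀ g ∉ A, ∀ γ : Γ, γ ≠ 1 → φ γ * g ∈ A
  parent_mul : ∀ g ∉ A, ∀ γ : Γ, γ ≠ 1 → p (φ γ * g) = g

namespace IsParentSystem

variable {Γ : Type u} {G : Type v} [Group Γ] [Group G] {φ : Γ →* G} {A : Set G} {p : G → G}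

theorem congr (h : IsParentSystem φ A p) {q : G → G} (hq : ∀ g ∈ A, q g = p g) :
    IsParentSystem φ A q where
  parent_notMem g hg := by rw [hq g hg]; exact h.parent_notMem g hg
  exists_eq_mul_parent g hg := by rw [hq g hg]; exact h.exists_eq_mul_parent g hg
  mul_mem := h.mul_mem
  parent_mul g hg γ hγ := by rw [hq _ (h.mul_mem g hg γ hγ)]; exact h.parent_mul g hg γ hγ

theorem eq_one_of_mul_notMem (h : IsParentSystem φ A p) {g : G} (hg : g ∉ A) {γ : Γ}
    (hγ : φ γ * g ∉ A) : γ = 1 :=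
  by_contra fun h1 => hγ (h.mul_mem g hg γ h1)

theorem exists_eq_mul_notMem (h : IsParentSystem φ A p) (g : G) :
    ∃ γ : Γ, ∃ r ∉ A, g = φ γ * r := by
  by_cases hg : g ∈ A
  · obtain ⟨γ, hγ⟩ := h.exists_eq_mul_parent g hg
    exact ⟨γ, p g, h.parent_notMem g hg, hγ⟩
  · exact ⟨1, g, hg, by simp⟩

theorem bijective_mul (h : IsParentSystem φ A p) :
    Function.Bijective fun q : (Aᶜ : Set G) × Γ => φ q.2 * (q.1 : G) := by
  constructor
  · rintro ⟨⟨r, hr⟩, γ⟩ ⟨⟨r', hr'⟩, γ'⟩ hq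
    have hq : φ γ * r = φ γ' * r' := hq
    have h1 : r = φ (γ⁻¹ * γ') * r' := by
      rw [map_mul, mul_assoc, ← hq, map_inv, inv_mul_cancel_left]
    have h2 : γ⁻¹ * γ' = 1 := h.eq_one_of_mul_notMem hr' (by rwa [← h1])
    obtain rfl : γ = γ' := inv_mul_eq_one.1 h2
    obtain rfl : r = r' := mul_left_cancel hq
    rfl
  · intro g
    obtain ⟨γ, r, hr, hg⟩ := h.exists_eq_mul_notMem g
    exact ⟨(⟨r, hr⟩, γ), hg.symm⟩

end IsParentSystem

section Words

open Monoid.CoprodI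

variable {ι : Type*} {M : ι → Type*} [∀ i, Group (M i)]

/-- Elements of a group `G` mapping to a free product are sorted by the first letter of the reduced
word of their image; a subgroup of `G` mapping isomorphically to a factor then has a parent system,
in which parents have shorter words. -/
theorem exists_isParentSystem_of_word [DecidableEq ι] [∀ i, DecidableEq (M i)]
    {Γ : Type u} {G : Type v} [Group Γ] [Group G]
    (f : G →* Monoid.CoprodI M) (φ : Γ →* G) (i : ι) (e : Γ ≃* M i)
    (hf : ∀ γ, f (φ γ) = of (e γ)) :
    ∃ p : G → G,
      IsParentSystem φ {g | (f g • (Word.empty : Word M)).fstIdx = some i} p ∧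
      ∀ g, (f g • (Word.empty : Word M)).fstIdx = some i →
        (f (p g) • (Word.empty : Word M)).toList.length <
          (f g • (Word.empty : Word M)).toList.length := by
  set W : G → Word M := fun g => f g • (Word.empty : Word M) with hW
  have hWmul (γ : Γ) (g : G) : W (φ γ * g) = of (e γ) • W g := by
    simp only [hW, map_mul, hf, mul_smul]
  let p : G → G := fun g => (φ (e.symm (Word.equivPair i (W g)).head))⁻¹ * g
  have hmul (g : G) : g = φ (e.symm (Word.equivPair i (W g)).head) * p g := by simp [p]
  have hWp (g : G) : W (p g) = (Word.equivPair i (W g)).tail := by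
    have h := hWmul (e.symm (Word.equivPair i (W g)).head) (p g)
    rw [← hmul, e.apply_symm_apply] at h
    conv_lhs at h => rw [← Word.equivPair_head_smul_equivPair_tail (i := i) (W g)]
    exact (smul_left_cancel _ h).symm
  refine ⟨p, ⟨fun g _ => ?_, fun g _ => ⟨_, hmul g⟩, fun g hg γ hγ => ?_, fun g hg γ hγ => ?_⟩,
    fun g hg => ?_⟩
  · change ¬ (W (p g)).fstIdx = some i
    rw [hWp]
    exact (Word.equivPair i (W g)).fstIdx_ne
  · have hg : ¬ (W g).fstIdx = some i := hg
    change (W (φ γ * g)).fstIdx = some i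
    have hγ' : e γ ≠ 1 := by simpa using hγ
    rw [hWmul, ← Word.cons_eq_smul (h1 := hg) (h2 := hγ'), Word.fstIdx_cons]
  · have hg : ¬ (W g).fstIdx = some i := hg
    have : (Word.equivPair i (W (φ γ * g))).head = e γ := by
      rw [hWmul, Word.equivPair_smul_same, Word.equivPair_eq_of_fstIdx_ne hg]
      simp
    simp [p, this]
  · have hg : (W g).fstIdx = some i := hg
    change (W (p g)).toList.length < (W g).toList.length
    have h1 : Word.rcons (Word.equivPair i (W g)) = W g := by
      rw [← Word.equivPair_symm, Equiv.symm_apply_apply]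
    have hh : (Word.equivPair i (W g)).head ≠ 1 := by
      intro h0
      rw [Word.rcons, dif_pos h0] at h1
      exact (Word.equivPair i (W g)).fstIdx_ne (by rw [h1]; exact hg)
    rw [Word.rcons, dif_neg hh] at h1
    rw [hWp, ← congrArg (fun w => w.toList.length) h1]
    simp [Word.cons]

end Words

/-- The two factors of a free product, lifted to a common universe, as a family indexed by
`Bool`. -/
def coprodFamily (Γ₀ : Type u) (Γ₁ : Type v) : Bool → Type (max u v)
  | false => ULift.{v} Γ₀
  | true => ULift.{u} Γ₁

instance instGroupCoprodFamily (Γ₀ : Type u) (Γ₁ : Type v) [Group Γ₀] [Group Γ₁] :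
    ∀ b, Group (coprodFamily Γ₀ Γ₁ b)
  | false => (ULift.group : Group (ULift.{v} Γ₀))
  | true => (ULift.group : Group (ULift.{u} Γ₁))

/-- The two factors of a free product have parent systems with disjoint sets and a common parent
map, which decreases a length function: this is the Bass--Serre tree of the free product. -/
theorem exists_isParentSystem_coprod (Γ₀ : Type u) (Γ₁ : Type v) [Group Γ₀] [Group Γ₁] :
    ∃ (A₀ A₁ : Set (Monoid.Coprod Γ₀ Γ₁)) (p : Monoid.Coprod Γ₀ Γ₁ → Monoid.Coprod Γ₀ Γ₁)
      (ℓ : Monoid.Coprod Γ₀ Γ₁ → ℕ), Disjoint A₀ A₁ ∧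
      IsParentSystem (Monoid.Coprod.inl : Γ₀ →* Monoid.Coprod Γ₀ Γ₁) A₀ p ∧
      IsParentSystem (Monoid.Coprod.inr : Γ₁ →* Monoid.Coprod Γ₀ Γ₁) A₁ p ∧
      ∀ g ∈ A₀ ∪ A₁, ℓ (p g) < ℓ g := by
  classical
  let M := coprodFamily Γ₀ Γ₁
  let e₀ : Γ₀ ≃* M false := (MulEquiv.ulift.{u, v} (α := Γ₀)).symm
  let e₁ : Γ₁ ≃* M true := (MulEquiv.ulift.{v, u} (α := Γ₁)).symm
  let f : Monoid.Coprod Γ₀ Γ₁ →* Monoid.CoprodI M :=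
    Monoid.Coprod.lift ((Monoid.CoprodI.of (i := false)).comp e₀.toMonoidHom)
      ((Monoid.CoprodI.of (i := true)).comp e₁.toMonoidHom)
  obtain ⟨p₀, h₀, hl₀⟩ := exists_isParentSystem_of_word f
    (Monoid.Coprod.inl : Γ₀ →* Monoid.Coprod Γ₀ Γ₁) false e₀ (fun γ => by simp [f])
  obtain ⟨p₁, h₁, hl₁⟩ := exists_isParentSystem_of_word f
    (Monoid.Coprod.inr : Γ₁ →* Monoid.Coprod Γ₀ Γ₁) true e₁ (fun γ => by simp [f])
  let A (b : Bool) : Set (Monoid.Coprod Γ₀ Γ₁) :=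
    {g | (f g • (Monoid.CoprodI.Word.empty : Monoid.CoprodI.Word M)).fstIdx = some b}
  have hA : Disjoint (A false) (A true) := by
    refine Set.disjoint_left.2 fun g hg hg' => ?_
    have h : some false = some true := hg.symm.trans hg'
    simp at h
  let p : Monoid.Coprod Γ₀ Γ₁ → Monoid.Coprod Γ₀ Γ₁ := (A false).piecewise p₀ p₁
  have hp₀ : ∀ g ∈ A false, p g = p₀ g := fun g hg => Set.piecewise_eq_of_mem _ _ _ hg
  have hp₁ : ∀ g ∈ A true, p g = p₁ g := fun g hg =>
    Set.piecewise_eq_of_notMem _ _ _ (Set.disjoint_right.1 hA hg)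
  refine ⟨A false, A true, p, fun g => (f g • (Monoid.CoprodI.Word.empty :
    Monoid.CoprodI.Word M)).toList.length, hA,
    h₀.congr hp₀, h₁.congr hp₁, ?_⟩
  rintro g (hg | hg)
  · rw [hp₀ g hg]; exact hl₀ g hg
  · rw [hp₁ g hg]; exact hl₁ g hg

/-! ### Product measures -/

section ProductMeasures

open ProbabilityTheory

/-- The coordinates in `A` are kept, the others are replaced by `1`. -/
noncomputable def mask {ι : Type u} {X : Type v} [One X] (A : Set ι) (x : ι → X) : ι → X :=
  open Classical in fun i => if i ∈ A then x i else 1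

theorem mask_of_mem {ι : Type u} {X : Type v} [One X] {A : Set ι} {i : ι} (hi : i ∈ A)
    (x : ι → X) : mask A x i = x i :=
  if_pos hi

theorem mask_of_notMem {ι : Type u} {X : Type v} [One X] {A : Set ι} {i : ι} (hi : i ∉ A)
    (x : ι → X) : mask A x i = 1 :=
  if_neg hi

variable {ι : Type u} {X : Type v} [MeasurableSpace X]

theorem comap_mask_le [One X] (A : Set ι) :
    MeasurableSpace.comap (mask A : (ι → X) → ι → X) inferInstance ≤
      ⨆ i ∈ A, MeasurableSpace.comap (fun x : ι → X => x i) inferInstance := by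
  rw [← measurable_iff_comap_le]
  refine @measurable_pi_lambda _ _ _ (_) _ _ fun i => ?_
  by_cases hi : i ∈ A
  · simp only [mask_of_mem hi]
    rw [measurable_iff_comap_le]
    exact le_iSup₂_of_le i hi le_rfl
  · simp only [mask_of_notMem hi]
    exact measurable_const

theorem measurable_mask [One X] (A : Set ι) : Measurable (mask A : (ι → X) → ι → X) := by
  refine measurable_pi_lambda _ fun i => ?_
  by_cases hi : i ∈ A
  · simpa only [mask_of_mem hi] using measurable_pi_apply i
  · simpa only [mask_of_notMem hi] using measurable_const

theorem indepFun_mask [One X] (ν : Measure X) [IsProbabilityMeasure ν] {A B : Set ι}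
    (hAB : Disjoint A B) :
    IndepFun (mask A) (mask B) (Measure.infinitePi fun _ : ι => ν) := by
  have h : iIndepFun (fun (i : ι) (x : ι → X) => x i) (Measure.infinitePi fun _ : ι => ν) :=
    iIndepFun_infinitePi (X := fun _ x => x) (fun _ => measurable_id)
  rw [iIndepFun_iff_iIndep] at h
  rw [IndepFun_iff_Indep]
  exact indep_of_indep_of_le_left (indep_of_indep_of_le_right
    (indep_iSup_of_disjoint (fun i => (measurable_pi_apply i).comap_le) h hAB)
    (comap_mask_le B)) (comap_mask_le A)

/-- Multiplying a Haar distributed random variable by a function of an independent one preserves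
both its law and the independence. -/
theorem measure_inter_inv_mul_mem {Ω : Type u} {Z : Type v} {K : Type w} [MeasurableSpace Ω]
    [MeasurableSpace Z] [Group K] [MeasurableSpace K] [MeasurableMul₂ K] [MeasurableInv K]
    {P : Measure Ω} [IsProbabilityMeasure P] {κ : Measure K} [IsProbabilityMeasure κ]
    [κ.IsMulLeftInvariant]
    {f : Ω → Z} {k : Ω → K} (hf : Measurable f) (hk : MeasurePreserving k P κ)
    (hfk : IndepFun f k P) {h : Z → K} (hh : Measurable h) {s : Set Z} (hs : MeasurableSet s)
    {t : Set K} (ht : MeasurableSet t) :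
    P (f ⁻¹' s ∩ {ω | (h (f ω))⁻¹ * k ω ∈ t}) = P (f ⁻¹' s) * κ t := by
  have hlaw := hfk.map_prod_eq_prod_map_map hf.aemeasurable hk.measurable.aemeasurable
  rw [hk.map_eq] at hlaw
  have : IsProbabilityMeasure (P.map f) := Measure.isProbabilityMeasure_map hf.aemeasurable
  have hS : MeasurableSet {q : Z × K | q.1 ∈ s ∧ (h q.1)⁻¹ * q.2 ∈ t} :=
    (measurable_fst hs).inter
      (((hh.comp measurable_fst).inv.mul measurable_snd : Measurable _) ht)
  have h1 : P (f ⁻¹' s ∩ {ω | (h (f ω))⁻¹ * k ω ∈ t}) =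
      (P.map fun ω => (f ω, k ω)) {q : Z × K | q.1 ∈ s ∧ (h q.1)⁻¹ * q.2 ∈ t} := by
    rw [Measure.map_apply (hf.prodMk hk.measurable) hS]
    rfl
  rw [h1, hlaw, Measure.prod_apply hS]
  have h2 : ∀ z : Z, κ (Prod.mk z ⁻¹' {q : Z × K | q.1 ∈ s ∧ (h q.1)⁻¹ * q.2 ∈ t}) =
      s.indicator (fun _ => κ t) z := by
    intro z
    by_cases hz : z ∈ s
    · simp only [Set.preimage_ofPred_eq, hz, true_and, Set.indicator_of_mem]
      exact measure_preimage_mul κ _ t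
    · simp [hz]
  simp only [h2]
  rw [lintegral_indicator_const hs, Measure.map_apply hf hs, mul_comm]

/-- Two independent families, each i.i.d., form an i.i.d. family of pairs. -/
theorem measurePreserving_zip {Y₀ : Type v} {Y₁ : Type w} [MeasurableSpace Y₀] [MeasurableSpace Y₁]
    (ν₀ : Measure Y₀) (ν₁ : Measure Y₁) [IsProbabilityMeasure ν₀] [IsProbabilityMeasure ν₁] :
    MeasurePreserving (fun (z : (ι → Y₀) × (ι → Y₁)) (i : ι) => (z.1 i, z.2 i))
      ((Measure.infinitePi fun _ : ι => ν₀).prod (Measure.infinitePi fun _ : ι => ν₁))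
      (Measure.infinitePi fun _ : ι => ν₀.prod ν₁) := by
  classical
  set m := Measure.infinitePi fun _ : ι => ν₀.prod ν₁
  have hm : Measurable (fun (z : (ι → Y₀) × (ι → Y₁)) (i : ι) => (z.1 i, z.2 i)) := by fun_prop
  have hu : Measurable (fun (z : ι → Y₀ × Y₁) => ((fun i => (z i).1), (fun i => (z i).2))) := by
    fun_prop
  -- It is easier to see that the inverse map preserves the measures: the preimage of a product of
  -- boxes is a box.
  suffices h : (Measure.infinitePi fun _ : ι => ν₀).prod (Measure.infinitePi fun _ : ι => ν₁) =
      m.map (fun (z : ι → Y₀ × Y₁) => ((fun i => (z i).1), (fun i => (z i).2))) by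
    refine ⟨hm, ?_⟩
    rw [h, Measure.map_map hm hu]
    exact Measure.map_id
  refine Measure.prod_eq_generateFrom (generateFrom_squareCylinders)
    (generateFrom_squareCylinders)
    (isPiSystem_squareCylinders (fun _ => MeasurableSpace.isPiSystem_measurableSet) (by simp))
    (isPiSystem_squareCylinders (fun _ => MeasurableSpace.isPiSystem_measurableSet) (by simp))
    ⟨fun _ => Set.univ, fun _ => ⟨∅, fun _ => Set.univ, by simp⟩, fun _ => measure_lt_top _ _,
      Set.iUnion_const _⟩
    ⟨fun _ => Set.univ, fun _ => ⟨∅, fun _ => Set.univ, by simp⟩, fun _ => measure_lt_top _ _,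
      Set.iUnion_const _⟩ ?_
  rintro _ ⟨s, t, ht, rfl⟩ _ ⟨s', t', ht', rfl⟩
  replace ht : ∀ i, MeasurableSet (t i) := by simpa using ht
  replace ht' : ∀ i, MeasurableSet (t' i) := by simpa using ht'
  rw [Measure.map_apply hu ((MeasurableSet.pi s.countable_toSet fun i _ => ht i).prod
    (MeasurableSet.pi s'.countable_toSet fun i _ => ht' i))]
  have hbox : (fun (z : ι → Y₀ × Y₁) => ((fun i => (z i).1), (fun i => (z i).2))) ⁻¹'
      ((s : Set ι).pi t ×ˢ (s' : Set ι).pi t') =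
      ((s ∪ s' : Finset ι) : Set ι).pi fun i =>
        (if i ∈ s then t i else Set.univ) ×ˢ (if i ∈ s' then t' i else Set.univ) := by
    ext z
    simp only [Set.mem_preimage, Set.mem_prod, Set.mem_pi, Finset.mem_coe, Finset.mem_union]
    constructor
    · rintro ⟨h, h'⟩ i -
      constructor
      · split_ifs with hi
        exacts [h i hi, Set.mem_univ _]
      · split_ifs with hi
        exacts [h' i hi, Set.mem_univ _]
    · intro h
      refine ⟨fun i hi => ?_, fun i hi => ?_⟩
      · have := (h i (Or.inl hi)).1
        rwa [if_pos hi] at this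
      · have := (h i (Or.inr hi)).2
        rwa [if_pos hi] at this
  have hbm (i : ι) : MeasurableSet
      ((if i ∈ s then t i else Set.univ) ×ˢ (if i ∈ s' then t' i else Set.univ)) := by
    refine MeasurableSet.prod ?_ ?_ <;> split_ifs
    exacts [ht i, MeasurableSet.univ, ht' i, MeasurableSet.univ]
  rw [hbox, Measure.infinitePi_pi _ (fun i _ => hbm i), Measure.infinitePi_pi _ (fun i _ => ht i),
    Measure.infinitePi_pi _ (fun i _ => ht' i)]
  simp only [Measure.prod_prod, Finset.prod_mul_distrib]
  congr 1
  · rw [← Finset.prod_subset (Finset.subset_union_left (s₁ := s) (s₂ := s'))]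
    · exact Finset.prod_congr rfl fun i hi => by rw [if_pos hi]
    · intro i _ hi
      simp [hi]
  · rw [← Finset.prod_subset (Finset.subset_union_right (s₁ := s) (s₂ := s'))]
    · exact Finset.prod_congr rfl fun i hi => by rw [if_pos hi]
    · intro i _ hi
      simp [hi]

end ProductMeasures

/-! ### Increments along a rooted forest -/

section Increments

open ProbabilityTheory

variable {ι : Type u} {K : Type v} [Group K]

/-- The increments `x_{p(i)}⁻¹ x_i` of `x` along a forest with vertex set `ι`, in which the parent
of `i ∈ A` is `p i` and the elements outside `A` are roots, where the increment is `x_i`. -/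
noncomputable def increments (A : Set ι) (p : ι → ι) (x : ι → K) : ι → K :=
  fun i => (mask A (x ∘ p) i)⁻¹ * x i

theorem increments_of_mem {A : Set ι} {i : ι} (hi : i ∈ A) (p : ι → ι) (x : ι → K) :
    increments A p x i = (x (p i))⁻¹ * x i := by
  rw [increments, mask_of_mem hi, Function.comp_apply]

/-- The increments of a family of independent Haar distributed elements of a group are again
independent and Haar distributed. -/
theorem measurePreserving_increments [MeasurableSpace K] [MeasurableMul₂ K] [MeasurableInv K]
    (κ : Measure K) [IsProbabilityMeasure κ] [κ.IsMulLeftInvariant] {A : Set ι} {p : ι → ι}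
    {ℓ : ι → ℕ} (hℓ : ∀ i ∈ A, ℓ (p i) < ℓ i) :
    MeasurePreserving (increments A p) (Measure.infinitePi fun _ : ι => κ)
      (Measure.infinitePi fun _ : ι => κ) := by
  classical
  set μ := Measure.infinitePi fun _ : ι => κ
  have hcoord (i : ι) : Measurable fun x : ι → K => mask A (x ∘ p) i := by
    have h : Measurable fun x : ι → K => x ∘ p := by
      rw [measurable_pi_iff]; exact fun j => measurable_pi_apply _
    exact (measurable_pi_apply i).comp ((measurable_mask A).comp h)
  have hm (i : ι) : Measurable fun x : ι → K => increments A p x i :=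
    (hcoord i).inv.mul (measurable_pi_apply i)
  refine ⟨measurable_pi_lambda _ hm, Measure.eq_infinitePi _ fun s t ht => ?_⟩
  rw [Measure.map_apply (measurable_pi_lambda _ hm)
    (MeasurableSet.pi s.countable_toSet fun i _ => ht i)]
  -- The vertices are added in the order of increasing `ℓ`, so that the coordinate of the new vertex
  -- does not enter into the previous increments.
  induction s using Finset.induction_on_max_value ℓ with
  | empty => simp
  | insert a s has hmax ih =>
    set E : Set (ι → K) := increments A p ⁻¹' (s : Set ι).pi t
    have hE : MeasurableSet E :=
      measurable_pi_lambda _ hm (MeasurableSet.pi s.countable_toSet fun i _ => ht i)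
    have hpa (i : ι) (hi : i ∈ A) (hia : ℓ i ≤ ℓ a) : p i ≠ a := by
      intro h
      have := hℓ i hi
      rw [h] at this
      omega
    have hmask (x : ι → K) (i : ι) (hi : ℓ i ≤ ℓ a) :
        mask A (mask {a}ᶜ x ∘ p) i = mask A (x ∘ p) i := by
      by_cases hA : i ∈ A
      · rw [mask_of_mem hA, mask_of_mem hA]
        exact mask_of_mem (hpa i hA hi) x
      · rw [mask_of_notMem hA, mask_of_notMem hA]
    have hEmask : mask {a}ᶜ ⁻¹' E = E := by
      ext x
      simp only [E, Set.mem_preimage, Set.mem_pi]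
      refine forall₂_congr fun i hi => ?_
      have hia : i ∈ ({a}ᶜ : Set ι) := by
        rintro rfl
        exact has hi
      rw [increments, increments, hmask x i (hmax i hi), mask_of_mem hia]
    have hsplit : increments A p ⁻¹' ((insert a s : Finset ι) : Set ι).pi t =
        mask {a}ᶜ ⁻¹' E ∩ {x | (mask A (mask {a}ᶜ x ∘ p) a)⁻¹ * x a ∈ t a} := by
      rw [hEmask]
      ext x
      simp only [E, Finset.coe_insert, Set.insert_pi, Set.mem_preimage, Set.mem_inter_iff,
        Set.mem_ofPred_eq, hmask x a le_rfl, Function.eval]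
      exact and_comm
    have hind : IndepFun (mask {a}ᶜ) (fun x : ι → K => x a) μ := by
      have h := (indepFun_mask κ (disjoint_compl_left : Disjoint ({a}ᶜ : Set ι) {a})).comp
        measurable_id (measurable_pi_apply a)
      refine h.congr (ae_of_all _ fun x => rfl) (ae_of_all _ fun x => ?_)
      exact mask_of_mem (Set.mem_singleton a) x
    rw [hsplit, measure_inter_inv_mul_mem (measurable_mask _)
      (measurePreserving_eval_infinitePi (fun _ : ι => κ) a) hind (hcoord a) hE (ht a), hEmask, ih,
      Finset.prod_insert has, mul_comm]

end Increments

/-! ### Isomorphisms of `K ^ Γ / K` with Bernoulli actions -/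

section Isomorphisms

variable {K : Type w} [Group K] [TopologicalSpace K] [IsTopologicalGroup K] [CompactSpace K]
  [T2Space K] [SecondCountableTopology K] [MeasurableSpace K] [BorelSpace K]

/-- An isomorphism of `Γ ↷ K ^ Γ / K` with a Bernoulli action is injective and equivariant on a
conegligible Borel set. -/
theorem exists_injOn_equivariantOn_of_isomorphic {Γ : Type u} [Group Γ] [Countable Γ] {Y : Type v}
    [MeasurableSpace Y] [StandardBorelSpace Y] {ν : Measure Y} [IsProbabilityMeasure ν]
    (h : (factorAction K Γ).Isomorphic (bernoulliAction Γ Y ν)) :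
    ∃ Δ : DiagQuotient K Γ → Γ → Y,
      MeasurePreserving Δ (DiagQuotient.measure K Γ) (Measure.infinitePi fun _ : Γ => ν) ∧
      ∃ A : Set (DiagQuotient K Γ), MeasurableSet A ∧ (∀ᵐ ω ∂DiagQuotient.measure K Γ, ω ∈ A) ∧
        Set.InjOn Δ A ∧
        ∀ γ : Γ, ∀ ω ∈ A, Δ (DiagQuotient.shift K Γ γ ω) = fun h => Δ ω (h * γ) := by
  obtain ⟨Δ, ⟨hΔ, A, _, hA, -, hA0, -, hbij⟩, hequi⟩ := h
  have hequi' : ∀ᵐ ω ∂DiagQuotient.measure K Γ, ∀ γ : Γ,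
      Δ (DiagQuotient.shift K Γ γ ω) = fun h => Δ ω (h * γ) := ae_all_iff.2 hequi
  obtain ⟨t, htsub, htm, ht0⟩ := exists_measurable_superset_of_null hequi'
  refine ⟨Δ, hΔ, A ∩ tᶜ, hA.inter htm.compl, ?_, hbij.injOn.mono Set.inter_subset_left, ?_⟩
  · have h1 : ∀ᵐ ω ∂DiagQuotient.measure K Γ, ω ∈ A := hA0
    have h2 : ∀ᵐ ω ∂DiagQuotient.measure K Γ, ω ∈ tᶜ := by
      rw [ae_iff]; simpa using ht0
    filter_upwards [h1, h2] with ω ha ht using ⟨ha, ht⟩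
  · intro γ ω hω
    by_contra hne
    exact hω.2 (htsub fun hall => hne (hall γ))

/-- By the Lusin--Souslin theorem it suffices for an isomorphism to be injective on a conegligible
Borel set. -/
theorem isomorphic_of_injOn_of_equivariant {Γ : Type u} [Group Γ] [Countable Γ] {Y : Type v}
    [MeasurableSpace Y] [StandardBorelSpace Y] {ν : Measure Y} [IsProbabilityMeasure ν]
    {Δ : DiagQuotient K Γ → Γ → Y}
    (hΔ : MeasurePreserving Δ (DiagQuotient.measure K Γ) (Measure.infinitePi fun _ : Γ => ν))
    {A : Set (DiagQuotient K Γ)} (hA : MeasurableSet A)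
    (hA1 : ∀ᵐ ω ∂DiagQuotient.measure K Γ, ω ∈ A) (hinj : Set.InjOn Δ A)
    (hequi : ∀ (γ : Γ) ω, Δ (DiagQuotient.shift K Γ γ ω) = fun h => Δ ω (h * γ)) :
    (factorAction K Γ).Isomorphic (bernoulliAction Γ Y ν) := by
  have hB : MeasurableSet (Δ '' A) := hA.image_of_measurable_injOn hΔ.measurable hinj
  refine ⟨Δ, ⟨hΔ, A, Δ '' A, hA, hB, hA1, ?_, hinj.bijOn_image⟩, fun γ => ae_of_all _ (hequi γ)⟩
  change (Measure.infinitePi fun _ : Γ => ν) (Δ '' A)ᶜ = 0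
  rw [← hΔ.measure_preimage hB.compl.nullMeasurableSet]
  exact measure_mono_null (fun ω hω hωA => hω ⟨ω, hωA, rfl⟩) hA1

end Isomorphisms

/-! ### Coinduction -/

namespace DiagQuotient

section Restriction

variable (K : Type w) [Group K] {Γ : Type u} {G : Type v}

/-- The map `K ^ G / K → K ^ Γ / K` of composition with `f : Γ → G`. -/
def comap (f : Γ → G) : DiagQuotient K G → DiagQuotient K Γ :=
  Quotient.map (fun (x : G → K) (γ : Γ) => x (f γ)) (by
    rintro _ y ⟨k, rfl⟩
    exact ⟨k, rfl⟩)

theorem measurable_comap [MeasurableSpace K] (f : Γ → G) : Measurable (comap K f) := by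
  intro s hs
  have h : Measurable fun (x : G → K) (γ : Γ) => x (f γ) := by fun_prop
  exact h (measurable_mk K Γ hs)

theorem measurePreserving_comap [TopologicalSpace K] [IsTopologicalGroup K] [CompactSpace K]
    [MeasurableSpace K] [BorelSpace K] {f : Γ → G} (hf : Function.Injective f) :
    MeasurePreserving (comap K f) (DiagQuotient.measure K G) (DiagQuotient.measure K Γ) := by
  refine ⟨measurable_comap K f, ?_⟩
  have h : Measurable fun (x : G → K) (γ : Γ) => x (f γ) := by fun_prop
  have hc : comap K f ∘ mk K G = mk K Γ ∘ fun (x : G → K) (γ : Γ) => x (f γ) := rfl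
  rw [DiagQuotient.measure, Measure.map_map (measurable_comap K f) (measurable_mk K G), hc,
    ← Measure.map_map (measurable_mk K Γ) h,
    Measure.map_infinitePi_infinitePi_of_inj (P := fun _ : G => normalizedHaar K) hf]
  rfl

theorem mk_eq_mk_of_eq_mul {x y : Γ → K} {k : K} (h : ∀ γ, x γ = k * y γ) :
    mk K Γ x = mk K Γ y :=
  Quotient.sound ⟨k, (funext h).symm⟩

end Restriction

section Coinduction

variable {K : Type w} [Group K] {Γ : Type u} {G : Type v} [Group Γ] [Group G] (φ : Γ →* G)
  {Y : Type u₀} (Δ : DiagQuotient K Γ → Γ → Y)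

/-- The restriction of `K ^ G / K` to the coset `φ(Γ) g`, which is identified with `Γ` by means of
its element `g`. -/
def restrictCoset (g : G) : DiagQuotient K G → DiagQuotient K Γ :=
  comap K fun γ => φ γ * g

theorem restrictCoset_mul (γ : Γ) (g : G) (ω : DiagQuotient K G) :
    restrictCoset φ (φ γ * g) ω = shift K Γ γ (restrictCoset φ g ω) := by
  obtain ⟨x, rfl⟩ := Quotient.mk_surjective ω
  exact congrArg (mk K Γ) (funext fun h => congrArg x (by simp only [map_mul, mul_assoc]))

theorem restrictCoset_shift (k g : G) (ω : DiagQuotient K G) :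
    restrictCoset φ g (shift K G k ω) = restrictCoset φ (g * k) ω := by
  obtain ⟨x, rfl⟩ := Quotient.mk_surjective ω
  exact congrArg (mk K Γ) (funext fun h => congrArg x (mul_assoc _ _ _))

/-- The map `K ^ G / K → Y ^ G` coinduced from the map `Δ : K ^ Γ / K → Y ^ Γ` along `φ`: its
coordinate at `g` is the coordinate at `1` of `Δ` on the coset `φ(Γ) g`. For equivariant `Δ`, it
applies `Δ` on every coset of `φ(Γ)`. -/
def coind (ω : DiagQuotient K G) (g : G) : Y :=
  Δ (restrictCoset φ g ω) 1

theorem coind_shift (k : G) (ω : DiagQuotient K G) :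
    coind φ Δ (shift K G k ω) = fun g => coind φ Δ ω (g * k) := by
  funext g
  rw [coind, restrictCoset_shift, coind]

theorem coind_mul_of_equivariant {A : Set (DiagQuotient K Γ)}
    (hequi : ∀ γ : Γ, ∀ ω ∈ A, Δ (shift K Γ γ ω) = fun h => Δ ω (h * γ)) {ω : DiagQuotient K G}
    {g : G} (hω : restrictCoset φ g ω ∈ A) (γ : Γ) :
    coind φ Δ ω (φ γ * g) = Δ (restrictCoset φ g ω) γ := by
  simp only [coind, restrictCoset_mul, hequi γ _ hω, one_mul]

theorem measurable_coind [MeasurableSpace K] [MeasurableSpace Y] (hΔ : Measurable Δ) :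
    Measurable (coind φ Δ) :=
  measurable_pi_lambda _ fun _ =>
    (measurable_pi_apply (1 : Γ)).comp (hΔ.comp (measurable_comap K _))

variable [TopologicalSpace K] [IsTopologicalGroup K] [CompactSpace K] [MeasurableSpace K]
  [BorelSpace K] [MeasurableSpace Y]

/-- A map coinduced from an isomorphism of `K ^ Γ / K` with the Bernoulli action on `Y ^ Γ` carries
the measure of `K ^ G / K` to the product measure on `Y ^ G`: the cosets are disjoint, so that the
restrictions to them are independent. -/
theorem measurePreserving_coind [Countable Γ] [Countable G] {B : Set G} {p : G → G}
    (hφ : IsParentSystem φ B p) {ν : Measure Y} [IsProbabilityMeasure ν]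
    (hΔ : MeasurePreserving Δ (DiagQuotient.measure K Γ) (Measure.infinitePi fun _ : Γ => ν))
    {A : Set (DiagQuotient K Γ)} (hA : ∀ᵐ ω ∂DiagQuotient.measure K Γ, ω ∈ A)
    (hequi : ∀ γ : Γ, ∀ ω ∈ A, Δ (shift K Γ γ ω) = fun h => Δ ω (h * γ)) :
    MeasurePreserving (coind φ Δ) (DiagQuotient.measure K G)
      (Measure.infinitePi fun _ : G => ν) := by
  refine ⟨measurable_coind φ Δ hΔ.measurable, ?_⟩
  let R : Type v := (Bᶜ : Set G)
  let e : R × Γ ≃ G := Equiv.ofBijective _ hφ.bijective_mul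
  have he (r : R) (γ : Γ) : e (r, γ) = φ γ * (r : G) := rfl
  have hinj (g : G) : Function.Injective fun γ : Γ => φ γ * g := by
    intro γ γ' h
    obtain ⟨δ, r, hr, rfl⟩ := hφ.exists_eq_mul_notMem g
    have h1 : e (⟨r, hr⟩, γ * δ) = e (⟨r, hr⟩, γ' * δ) := by
      simpa only [he, map_mul, mul_assoc] using h
    simpa using h1
  -- The coinduced map agrees almost everywhere with the composition of three measure preserving
  -- maps: splitting `G` into cosets, `Δ` on each coset, and gluing the cosets.
  have hsplit : Measure.map (fun (x : G → K) (r : R) (γ : Γ) => x (e (r, γ)))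
      (Measure.infinitePi fun _ : G => normalizedHaar K) =
      Measure.infinitePi fun _ : R => Measure.infinitePi fun _ : Γ => normalizedHaar K := by
    rw [← Measure.infinitePi_map_curry (fun (_ : R) (_ : Γ) => normalizedHaar K),
      ← Measure.map_infinitePi_infinitePi_of_inj (P := fun _ : G => normalizedHaar K) e.injective,
      Measure.map_map (by fun_prop) (by fun_prop)]
    rfl
  have happly : Measure.map (fun (z : R → Γ → K) (r : R) => Δ (mk K Γ (z r)))
      (Measure.infinitePi fun _ : R => Measure.infinitePi fun _ : Γ => normalizedHaar K) =
      Measure.infinitePi fun _ : R => Measure.infinitePi fun _ : Γ => ν := by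
    rw [Measure.infinitePi_map_pi (f := fun (_ : R) (y : Γ → K) => Δ (mk K Γ y)) _
      (fun _ => hΔ.measurable.comp (measurable_mk K Γ))]
    have h : Measure.map (fun y : Γ → K => Δ (mk K Γ y))
        (Measure.infinitePi fun _ : Γ => normalizedHaar K) = Measure.infinitePi fun _ : Γ => ν := by
      rw [← hΔ.map_eq, DiagQuotient.measure, Measure.map_map hΔ.measurable (measurable_mk K Γ)]
      rfl
    rw [h]
  have hglue : Measure.map (fun (z : R → Γ → Y) (g : G) => z (e.symm g).1 (e.symm g).2)
      (Measure.infinitePi fun _ : R => Measure.infinitePi fun _ : Γ => ν) =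
      Measure.infinitePi fun _ : G => ν := by
    have h := Measure.map_infinitePi_infinitePi_of_inj (P := fun _ : R × Γ => ν) e.symm.injective
    rw [← h, ← Measure.infinitePi_map_curry_symm (fun (_ : R) (_ : Γ) => ν),
      Measure.map_map (by fun_prop) (by fun_prop)]
    rfl
  have hgood : ∀ᵐ x ∂(Measure.infinitePi fun _ : G => normalizedHaar K), ∀ r : R,
      restrictCoset φ (r : G) (mk K G x) ∈ A := by
    refine ae_all_iff.2 fun r => ?_
    have h := (measurePreserving_comap K (hinj (r : G))).quasiMeasurePreserving.ae hA
    exact ae_of_ae_map (measurable_mk K G).aemeasurable h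
  have hae : (fun x : G → K => coind φ Δ (mk K G x)) =ᵐ[Measure.infinitePi fun _ : G =>
      normalizedHaar K] fun (x : G → K) (g : G) =>
        Δ (mk K Γ fun γ => x (e ((e.symm g).1, γ))) (e.symm g).2 := by
    filter_upwards [hgood] with x hx
    funext g
    obtain ⟨⟨r, γ⟩, rfl⟩ := e.surjective g
    rw [e.symm_apply_apply]
    exact coind_mul_of_equivariant φ Δ hequi (hx r) γ
  have hm₁ : Measurable fun (x : G → K) (r : R) (γ : Γ) => x (e (r, γ)) := by fun_prop
  have hm₂ : Measurable fun (z : R → Γ → K) (r : R) => Δ (mk K Γ (z r)) :=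
    measurable_pi_lambda _ fun r =>
      (hΔ.measurable.comp (measurable_mk K Γ)).comp (measurable_pi_apply r)
  have hm₃ : Measurable fun (z : R → Γ → Y) (g : G) => z (e.symm g).1 (e.symm g).2 := by fun_prop
  rw [DiagQuotient.measure, Measure.map_map (measurable_coind φ Δ hΔ.measurable)
    (measurable_mk K G)]
  refine (Measure.map_congr hae).trans ?_
  rw [← hglue, ← happly, ← hsplit, Measure.map_map hm₂ hm₁, Measure.map_map hm₃ (hm₂.comp hm₁)]
  rfl

end Coinduction

end DiagQuotient

/-! ### The free product -/

namespace DiagQuotient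

/-- The restriction of `x` to a coset of `φ(Γ)`, modulo `K`, only depends on the increments of `x`
at the elements of the coset which are not its representative. -/
theorem coind_mk_mask_increments {K : Type w} [Group K] {Γ : Type u} {G : Type v} [Group Γ]
    [Group G] {φ : Γ →* G} {A B : Set G} {p : G → G} (hφ : IsParentSystem φ A p) (hAB : A ⊆ B)
    {Y : Type u₀} (Δ : DiagQuotient K Γ → Γ → Y) (x : G → K) :
    coind φ Δ (mk K G (mask A (increments B p x))) = coind φ Δ (mk K G x) := by
  funext g
  obtain ⟨δ, r, hr, rfl⟩ := hφ.exists_eq_mul_notMem g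
  refine congrArg (fun ω => Δ ω 1) (mk_eq_mk_of_eq_mul K (k := (x r)⁻¹) fun γ => ?_)
  change mask A (increments B p x) (φ γ * (φ δ * r)) = (x r)⁻¹ * x (φ γ * (φ δ * r))
  rw [← mul_assoc, ← map_mul]
  by_cases h1 : γ * δ = 1
  · rw [h1, map_one, one_mul, mask_of_notMem hr, inv_mul_cancel]
  · have hmem := hφ.mul_mem r hr _ h1
    rw [mask_of_mem hmem, increments_of_mem (hAB hmem), hφ.parent_mul r hr _ h1]

theorem mul_inv_eq_of_restrictCoset_eq {K : Type w} [Group K] {Γ : Type u} {G : Type v} [Group Γ]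
    [Group G] {φ : Γ →* G} {g : G} {x y : G → K}
    (h : restrictCoset φ g (mk K G x) = restrictCoset φ g (mk K G y)) (γ : Γ) :
    x (φ γ * g) * (y (φ γ * g))⁻¹ = x g * (y g)⁻¹ := by
  obtain ⟨k, hk⟩ := Quotient.exact h
  have hk' (δ : Γ) : k * y (φ δ * g) = x (φ δ * g) := congrFun hk δ
  have h1 := hk' 1
  rw [map_one, one_mul] at h1
  rw [← hk' γ, ← h1, mul_inv_cancel_right, mul_inv_cancel_right]

/-- An element of `K ^ G / K` is determined by its restrictions to the cosets of the two factors of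
`G`, because the factors generate `G`. -/
theorem eq_of_restrictCoset_eq {K : Type w} [Group K] {Γ₀ : Type u} {Γ₁ : Type v} [Group Γ₀]
    [Group Γ₁] {ω ω' : DiagQuotient K (Monoid.Coprod Γ₀ Γ₁)}
    (h₀ : ∀ g, restrictCoset (Monoid.Coprod.inl : Γ₀ →* _) g ω =
      restrictCoset Monoid.Coprod.inl g ω')
    (h₁ : ∀ g, restrictCoset (Monoid.Coprod.inr : Γ₁ →* _) g ω =
      restrictCoset Monoid.Coprod.inr g ω') : ω = ω' := by
  obtain ⟨x, rfl⟩ := Quotient.mk_surjective ω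
  obtain ⟨y, rfl⟩ := Quotient.mk_surjective ω'
  have key (g h : Monoid.Coprod Γ₀ Γ₁) : x (g * h) * (y (g * h))⁻¹ = x h * (y h)⁻¹ := by
    induction g using Monoid.Coprod.induction_on generalizing h with
    | inl γ => exact mul_inv_eq_of_restrictCoset_eq (h₀ h) γ
    | inr γ => exact mul_inv_eq_of_restrictCoset_eq (h₁ h) γ
    | mul a b ha hb => rw [mul_assoc, ha, hb]
  refine mk_eq_mk_of_eq_mul K (k := x 1 * (y 1)⁻¹) fun g => ?_
  rw [← key g 1, mul_one, inv_mul_cancel_right]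

section

variable {K : Type w} [Group K] [TopologicalSpace K] [IsTopologicalGroup K] [CompactSpace K]
  [SecondCountableTopology K] [MeasurableSpace K] [BorelSpace K]
  {G : Type v} [Group G]

/-- Two measure preserving maps coinduced from different factors are independent, since they depend
on disjoint sets of increments. -/
theorem measurePreserving_coind_prod {Γ₀ : Type u₀} {Γ₁ : Type u₁} [Group Γ₀] [Group Γ₁]
    {φ₀ : Γ₀ →* G} {φ₁ : Γ₁ →* G} {A₀ A₁ : Set G} {p : G → G} {ℓ : G → ℕ}
    (hA : Disjoint A₀ A₁) (hφ₀ : IsParentSystem φ₀ A₀ p) (hφ₁ : IsParentSystem φ₁ A₁ p)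
    (hℓ : ∀ g ∈ A₀ ∪ A₁, ℓ (p g) < ℓ g)
    {Y₀ : Type*} {Y₁ : Type*} [MeasurableSpace Y₀] [MeasurableSpace Y₁]
    {ν₀ : Measure (G → Y₀)} {ν₁ : Measure (G → Y₁)}
    {Δ₀ : DiagQuotient K Γ₀ → Γ₀ → Y₀} {Δ₁ : DiagQuotient K Γ₁ → Γ₁ → Y₁}
    (h₀ : MeasurePreserving (coind φ₀ Δ₀) (DiagQuotient.measure K G) ν₀)
    (h₁ : MeasurePreserving (coind φ₁ Δ₁) (DiagQuotient.measure K G) ν₁) :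
    MeasurePreserving (fun ω => (coind φ₀ Δ₀ ω, coind φ₁ Δ₁ ω)) (DiagQuotient.measure K G)
      (ν₀.prod ν₁) := by
  refine ⟨h₀.measurable.prodMk h₁.measurable, ?_⟩
  set μ := Measure.infinitePi fun _ : G => normalizedHaar K
  have : (normalizedHaar K).IsMulLeftInvariant := by unfold normalizedHaar; infer_instance
  have hT : MeasurePreserving (increments (A₀ ∪ A₁) p) μ μ :=
    measurePreserving_increments (normalizedHaar K) hℓ
  have hmk : MeasurePreserving (mk K G) μ (DiagQuotient.measure K G) := ⟨measurable_mk K G, rfl⟩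
  have hD₀ := h₀.comp hmk
  have hD₁ := h₁.comp hmk
  have hT₀ : (coind φ₀ Δ₀ ∘ mk K G ∘ mask A₀) ∘ increments (A₀ ∪ A₁) p = coind φ₀ Δ₀ ∘ mk K G :=
    funext fun x => coind_mk_mask_increments hφ₀ Set.subset_union_left Δ₀ x
  have hT₁ : (coind φ₁ Δ₁ ∘ mk K G ∘ mask A₁) ∘ increments (A₀ ∪ A₁) p = coind φ₁ Δ₁ ∘ mk K G :=
    funext fun x => coind_mk_mask_increments hφ₁ Set.subset_union_right Δ₁ x
  have hm₀ : Measurable (coind φ₀ Δ₀ ∘ mk K G ∘ mask A₀) :=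
    hD₀.measurable.comp (measurable_mask A₀)
  have hm₁ : Measurable (coind φ₁ Δ₁ ∘ mk K G ∘ mask A₁) :=
    hD₁.measurable.comp (measurable_mask A₁)
  have hmap₀ : μ.map (coind φ₀ Δ₀ ∘ mk K G ∘ mask A₀) = ν₀ := by
    rw [← hD₀.map_eq, ← hT₀, ← Measure.map_map hm₀ hT.measurable, hT.map_eq]
  have hmap₁ : μ.map (coind φ₁ Δ₁ ∘ mk K G ∘ mask A₁) = ν₁ := by
    rw [← hD₁.map_eq, ← hT₁, ← Measure.map_map hm₁ hT.measurable, hT.map_eq]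
  have hind := (indepFun_mask (normalizedHaar K) hA).comp hD₀.measurable hD₁.measurable
  have hlaw := hind.map_prod_eq_prod_map_map hm₀.aemeasurable hm₁.aemeasurable
  rw [DiagQuotient.measure, Measure.map_map (h₀.measurable.prodMk h₁.measurable)
    (measurable_mk K G)]
  calc
    μ.map ((fun ω => (coind φ₀ Δ₀ ω, coind φ₁ Δ₁ ω)) ∘ mk K G)
      = μ.map ((fun y => ((coind φ₀ Δ₀ ∘ mk K G ∘ mask A₀) y,
          (coind φ₁ Δ₁ ∘ mk K G ∘ mask A₁) y)) ∘ increments (A₀ ∪ A₁) p) := by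
        congr 1
        exact funext fun x => (Prod.ext (congrFun hT₀ x) (congrFun hT₁ x)).symm
    _ = (μ.map (coind φ₀ Δ₀ ∘ mk K G ∘ mask A₀)).prod (μ.map (coind φ₁ Δ₁ ∘ mk K G ∘ mask A₁)) := by
        rw [← Measure.map_map (hm₀.prodMk hm₁) hT.measurable, hT.map_eq]
        exact hlaw
    _ = ν₀.prod ν₁ := by rw [hmap₀, hmap₁]

end

end DiagQuotient

section FreeProduct

open DiagQuotient Monoid.Coprod

/-- If each `Γᵢ ↷ K ^ Γᵢ / K` is isomorphic to a Bernoulli action with base `Yᵢ`, then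
`G ↷ K ^ G / K` for the free product `G` of `Γ₀` and `Γ₁` is isomorphic to the Bernoulli action with
base `Y₀ × Y₁`. -/
theorem isomorphic_bernoulliAction_coprod {Γ₀ : Type u} {Γ₁ : Type v} [Group Γ₀] [Group Γ₁]
    [Countable Γ₀] [Countable Γ₁] {K : Type w} [Group K] [TopologicalSpace K]
    [IsTopologicalGroup K] [CompactSpace K] [T2Space K] [SecondCountableTopology K]
    [MeasurableSpace K] [BorelSpace K] {Y₀ : Type u₀} {Y₁ : Type u₁}
    [MeasurableSpace Y₀] [StandardBorelSpace Y₀] [MeasurableSpace Y₁] [StandardBorelSpace Y₁]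
    {ν₀ : Measure Y₀} {ν₁ : Measure Y₁} [IsProbabilityMeasure ν₀] [IsProbabilityMeasure ν₁]
    (h₀ : (factorAction K Γ₀).Isomorphic (bernoulliAction Γ₀ Y₀ ν₀))
    (h₁ : (factorAction K Γ₁).Isomorphic (bernoulliAction Γ₁ Y₁ ν₁)) :
    (factorAction K (Monoid.Coprod Γ₀ Γ₁)).Isomorphic
      (bernoulliAction (Monoid.Coprod Γ₀ Γ₁) (Y₀ × Y₁) (ν₀.prod ν₁)) := by
  obtain ⟨B₀, B₁, p, ℓ, hB, hp₀, hp₁, hℓ⟩ := exists_isParentSystem_coprod Γ₀ Γ₁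
  let i₀ : Γ₀ →* Monoid.Coprod Γ₀ Γ₁ := inl
  let i₁ : Γ₁ →* Monoid.Coprod Γ₀ Γ₁ := inr
  obtain ⟨Δ₀, hΔ₀, A₀, hA₀, hA₀', hinj₀, hequi₀⟩ := exists_injOn_equivariantOn_of_isomorphic h₀
  obtain ⟨Δ₁, hΔ₁, A₁, hA₁, hA₁', hinj₁, hequi₁⟩ := exists_injOn_equivariantOn_of_isomorphic h₁
  have hc₀ := measurePreserving_coind i₀ Δ₀ hp₀ hΔ₀ hA₀' hequi₀
  have hc₁ := measurePreserving_coind i₁ Δ₁ hp₁ hΔ₁ hA₁' hequi₁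
  have hmp := (measurePreserving_zip ν₀ ν₁).comp
    (measurePreserving_coind_prod hB hp₀ hp₁ hℓ hc₀ hc₁)
  let A : Set (DiagQuotient K (Monoid.Coprod Γ₀ Γ₁)) :=
    ⋂ g, restrictCoset i₀ g ⁻¹' A₀ ∩ restrictCoset i₁ g ⁻¹' A₁
  have hgood {ω} (hω : ω ∈ A) (g : Monoid.Coprod Γ₀ Γ₁) :
      restrictCoset i₀ g ω ∈ A₀ ∧ restrictCoset i₁ g ω ∈ A₁ := Set.mem_iInter.1 hω g
  have hA : MeasurableSet A :=
    MeasurableSet.iInter fun g => (measurable_comap K _ hA₀).inter (measurable_comap K _ hA₁)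
  refine isomorphic_of_injOn_of_equivariant hmp hA ?_ ?_ ?_
  · simp only [A, Set.mem_iInter]
    refine ae_all_iff.2 fun g => ?_
    have hg₀ := (measurePreserving_comap K (f := fun γ : Γ₀ => inl γ * g)
      ((mul_left_injective g).comp inl_injective)).quasiMeasurePreserving.ae hA₀'
    have hg₁ := (measurePreserving_comap K (f := fun γ : Γ₁ => inr γ * g)
      ((mul_left_injective g).comp inr_injective)).quasiMeasurePreserving.ae hA₁'
    filter_upwards [hg₀, hg₁] with ω h h' using ⟨h, h'⟩
  · intro ω hω ω' hω' h
    have hpair (g : Monoid.Coprod Γ₀ Γ₁) : coind i₀ Δ₀ ω g = coind i₀ Δ₀ ω' g ∧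
        coind i₁ Δ₁ ω g = coind i₁ Δ₁ ω' g := Prod.ext_iff.1 (congrFun h g)
    refine eq_of_restrictCoset_eq
      (fun g => hinj₀ (hgood hω g).1 (hgood hω' g).1 (funext fun γ => ?_))
      (fun g => hinj₁ (hgood hω g).2 (hgood hω' g).2 (funext fun γ => ?_))
    · exact (coind_mul_of_equivariant i₀ Δ₀ hequi₀ (hgood hω g).1 γ).symm.trans
        ((hpair _).1.trans (coind_mul_of_equivariant i₀ Δ₀ hequi₀ (hgood hω' g).1 γ))
    · exact (coind_mul_of_equivariant i₁ Δ₁ hequi₁ (hgood hω g).2 γ).symm.trans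
        ((hpair _).2.trans (coind_mul_of_equivariant i₁ Δ₁ hequi₁ (hgood hω' g).2 γ))
  · intro k ω
    simp only [Function.comp_apply, coind_shift]

theorem hasBernoulliFactor_coprod {Γ₀ : Type u} {Γ₁ : Type v} [Group Γ₀] [Group Γ₁]
    [Countable Γ₀] [Countable Γ₁] {K : Type w} [Group K] [TopologicalSpace K]
    [IsTopologicalGroup K] [CompactSpace K] [T2Space K] [SecondCountableTopology K]
    [MeasurableSpace K] [BorelSpace K] (h₀ : HasBernoulliFactor K Γ₀)
    (h₁ : HasBernoulliFactor K Γ₁) : HasBernoulliFactor K (Monoid.Coprod Γ₀ Γ₁) := by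
  obtain ⟨hinf, Y₀, _, _, ν₀, _, hi₀⟩ := h₀
  obtain ⟨-, Y₁, _, _, ν₁, _, hi₁⟩ := h₁
  exact ⟨Infinite.of_injective _ inl_injective, Y₀ × Y₁, inferInstance, inferInstance, ν₀.prod ν₁,
    inferInstance, isomorphic_bernoulliAction_coprod hi₀ hi₁⟩

end FreeProduct

theorem mainTheorem4 (Γ₀ : Type u) (Γ₁ : Type v) [Group Γ₀] [Group Γ₁] [Countable Γ₀]
    [Countable Γ₁] :
    (∀ (K : Type w) [Group K] [TopologicalSpace K] [IsTopologicalGroup K] [CompactSpace K]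
      [T2Space K] [SecondCountableTopology K] [Nontrivial K] [MeasurableSpace K] [BorelSpace K],
      (∀ (Y₀ : Type u₀) (Y₁ : Type u₁) [MeasurableSpace Y₀] [StandardBorelSpace Y₀]
        [MeasurableSpace Y₁] [StandardBorelSpace Y₁] (ν₀ : Measure Y₀) (ν₁ : Measure Y₁)
        [IsProbabilityMeasure ν₀] [IsProbabilityMeasure ν₁],
        (factorAction K Γ₀).Isomorphic (bernoulliAction Γ₀ Y₀ ν₀) →
        (factorAction K Γ₁).Isomorphic (bernoulliAction Γ₁ Y₁ ν₁) →
        (factorAction K (Monoid.Coprod Γ₀ Γ₁)).Isomorphic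
          (bernoulliAction (Monoid.Coprod Γ₀ Γ₁) (Y₀ × Y₁) (ν₀.prod ν₁))) ∧
      (HasBernoulliFactor K Γ₀ → HasBernoulliFactor K Γ₁ →
        HasBernoulliFactor K (Monoid.Coprod Γ₀ Γ₁))) ∧
    (HasAllBernoulliFactors.{u, w} Γ₀ → HasAllBernoulliFactors.{v, w} Γ₁ →
      HasAllBernoulliFactors.{max u v, w} (Monoid.Coprod Γ₀ Γ₁)) := by
  refine ⟨fun K _ _ _ _ _ _ _ _ _ => ⟨?_, hasBernoulliFactor_coprod⟩, fun h₀ h₁ => ?_⟩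
  · intro Y₀ Y₁ _ _ _ _ ν₀ ν₁ _ _ hi₀ hi₁
    exact isomorphic_bernoulliAction_coprod hi₀ hi₁
  · intro K _ _ _ _ _ _ _ _ _
    exact hasBernoulliFactor_coprod (h₀ K) (h₁ K)
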